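/- An MV-algebra is a commutative monoid $(A,\oplus,0)$ with a unary operation $\neg$ such that $\neg\neg x=x$, $x\oplus\neg 0=\neg 0$ and $\neg(\neg x\oplus y)\oplus y=\neg(\neg y\oplus x)\oplus x$. Put $1=\neg 0$, $x\vee y=\neg(\neg x\oplus y)\oplus y$, $x\wedge y=\neg(\neg x\vee\neg y)$, and $x\le y$ iff $x\vee y=y$. An ideal of $A$ is a nonempty downward closed subset closed under $\oplus$; it is proper if it is not $A$. A proper ideal $P$ is prime if $x\wedge y\in P$ implies $x\in P$ or $y\in P$, and $\mathrm{Spec}(A)$ is the set of prime ideals of $A$. For $I\subseteq A$ let $V(I)=\{P\in\mathrm{Spec}(A) : I\subseteq P\}$. A maximal ideal is a proper ideal maximal under inclusion among proper ideals; a maximal ideal $M$ is supermaximal if $A/M=\{0,1\}$. An MV-algebra is perfect if for every element $x$ exactly one of $x$ and $\neg x$ has finite order, where $x$ has finite order if $nx=x\oplus\cdots\oplus x=1$ for some $n\in\mathbb N$. An ideal $I$ of $A$ is perfect if the quotient $A/I$ (by the congruence $x\sim y$ iff $\neg(\neg x\oplus y)\oplus\neg(\neg y\oplus x)\in I$) is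 a perfect MV-algebra. The Chang algebra is $C=\Gamma(\mathbb Z\times_{\mathrm{lex}}\mathbb Z,(1,0))$, that is, the interval $[(0,0),(1,0)]$ of the lexicographically ordered group $\mathbb Z\times\mathbb Z$ with $x\oplus y=\min(x+y,(1,0))$ and $\neg x=(1,0)-x$; $\mathbb V(C)$ is the variety (equational class) of MV-algebras that it generates. **Theorem.** Let $k$ be a (possibly infinite) cardinal, let $\mathrm{Free}(k)$ be the free MV-algebra on $k$ generators, let $I$ be an ideal of $\mathrm{Free}(k)$, and let $A=\mathrm{Free}(k)/I$. The following are equivalent: 1. $A$ belongs to $\mathbb V(C)$; 2. every maximal ideal of $A$ is supermaximal; 3. every element of $\mathrm{Spec}(A)$ is a perfect ideal of $A$; 4. every element of $V(I)\subseteq\mathrm{Spec}(\mathrm{Free}(k))$ is a perfect ideal of $\mathrm{Free}(k)$. -/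

import Mathlib

universe u v

/-- An MV-algebra `(A, ⊕, 0, ¬)`; the operation `⊕` is written `+`. -/
class MVAlgebra (A : Type u) extends AddCommMonoid A where
  /-- The negation `¬`. -/
  neg : A → A
  neg_neg : ∀ x : A, neg (neg x) = x
  add_neg_zero : ∀ x : A, x + neg 0 = neg 0
  luk : ∀ x y : A, neg (neg x + y) + y = neg (neg y + x) + x

namespace MVAlgebra

variable {A : Type u} [MVAlgebra A]

/-- The unit `1 = ¬0`. -/
instance instOneMV : One A := ⟨neg 0⟩

/-- The lattice join `x ∨ y = ¬(¬x ⊕ y) ⊕ y`. -/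
def join (x y : A) : A := neg (neg x + y) + y

/-- The lattice meet `x ∧ y = ¬(¬x ∨ ¬y)`. -/
def meet (x y : A) : A := neg (join (neg x) (neg y))

/-- The lattice order: `x ≤ y` iff `x ∨ y = y`. -/
def le (x y : A) : Prop := join x y = y

/-- The truncated difference `x ⊖ y = ¬(¬x ⊕ y)`. -/
def diff (x y : A) : A := neg (neg x + y)

/-- The distance `d(x, y) = (x ⊖ y) ⊕ (y ⊖ x)`. -/
def mvDist (x y : A) : A := diff x y + diff y x

/-- `x` has finite order: `n x = x ⊕ ⋯ ⊕ x = 1` for some `n`. -/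
def HasFiniteOrder (x : A) : Prop := ∃ n : ℕ, n • x = (1 : A)

variable (A) in
/-- An MV-algebra is perfect if for every `x` exactly one of `x`, `¬x` has finite order. -/
def IsPerfect : Prop := ∀ x : A, Xor (HasFiniteOrder x) (HasFiniteOrder (neg x))

/-! Elementary facts needed for the quotient construction. -/

theorem one_def : (1 : A) = neg 0 := rfl

theorem neg_add_self (x : A) : neg x + x = 1 := by
  have h := luk (neg 0) x
  rw [add_neg_zero, neg_neg, zero_add] at h
  exact h

theorem le_iff {x y : A} : le x y ↔ neg x + y = 1 := by
  unfold le join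
  constructor
  · intro h
    rw [luk] at h
    rw [← h, add_comm (neg (neg y + x)) x, ← add_assoc, neg_add_self, add_comm, one_def,
      add_neg_zero]
  · intro h
    rw [h, one_def, neg_neg, zero_add]

theorem le_iff_exists {x y : A} : le x y ↔ ∃ z, y = x + z := by
  constructor
  · intro h
    refine ⟨neg (neg y + x), ?_⟩
    unfold le join at h
    rw [luk] at h
    rw [add_comm, h]
  · rintro ⟨z, rfl⟩
    rw [le_iff, ← add_assoc, neg_add_self, add_comm, one_def, add_neg_zero]

theorem le_add_of_diff_le {x y z : A} : le (diff x y) z ↔ le x (z + y) := by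
  rw [le_iff, le_iff, diff, neg_neg, add_assoc, add_comm y z]

theorem le_self (x : A) : le x x := le_iff.2 (neg_add_self x)

theorem le_trans' {x y z : A} (h : le x y) (h' : le y z) : le x z := by
  rw [le_iff_exists] at *
  obtain ⟨a, rfl⟩ := h
  obtain ⟨b, rfl⟩ := h'
  exact ⟨a + b, add_assoc _ _ _⟩

theorem add_le_add' {x y z w : A} (h : le x y) (h' : le z w) : le (x + z) (y + w) := by
  rw [le_iff_exists] at *
  obtain ⟨a, rfl⟩ := h
  obtain ⟨b, rfl⟩ := h'
  exact ⟨a + b, add_add_add_comm _ _ _ _⟩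

theorem le_diff_add (x y : A) : le x (diff x y + y) := le_add_of_diff_le.1 (le_self _)

theorem diff_triangle (x y z : A) : le (diff x z) (diff x y + diff y z) := by
  rw [le_add_of_diff_le, add_assoc]
  exact le_trans' (le_diff_add x y) (add_le_add' (le_self _) (le_diff_add y z))

theorem diff_add_add (x y z w : A) : le (diff (x + z) (y + w)) (diff x y + diff z w) := by
  rw [le_add_of_diff_le, add_add_add_comm]
  exact add_le_add' (le_diff_add x y) (le_diff_add z w)

theorem diff_neg_neg (x y : A) : diff (neg x) (neg y) = diff y x := by
  rw [diff, diff, neg_neg, add_comm]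

theorem diff_self (x : A) : diff x x = 0 := by
  rw [diff, neg_add_self, one_def, neg_neg]

theorem mvDist_self (x : A) : mvDist x x = 0 := by
  rw [mvDist, diff_self, zero_add]

theorem mvDist_comm (x y : A) : mvDist x y = mvDist y x := add_comm _ _

theorem mvDist_triangle (x y z : A) : le (mvDist x z) (mvDist x y + mvDist y z) := by
  have h := add_le_add' (diff_triangle x y z) (diff_triangle z y x)
  rw [add_comm (diff z y), add_add_add_comm] at h
  exact h

theorem mvDist_add_add (x y z w : A) : le (mvDist (x + z) (y + w)) (mvDist x y + mvDist z w) := by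
  have h := add_le_add' (diff_add_add x y z w) (diff_add_add y x w z)
  rw [add_add_add_comm] at h
  exact h

theorem mvDist_neg_neg (x y : A) : mvDist (neg x) (neg y) = mvDist x y := by
  rw [mvDist, diff_neg_neg, diff_neg_neg, mvDist_comm, mvDist]

end MVAlgebra

/-- An ideal of an MV-algebra: a nonempty downward closed set, closed under `⊕`. -/
@[ext]
structure MVIdeal (A : Type u) [MVAlgebra A] where
  carrier : Set A
  nonempty : carrier.Nonempty
  add_mem : ∀ {x y : A}, x ∈ carrier → y ∈ carrier → x + y ∈ carrier
  mem_of_le : ∀ {x y : A}, x ∈ carrier → MVAlgebra.le y x → y ∈ carrier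

namespace MVIdeal

open MVAlgebra

variable {A : Type u} [MVAlgebra A]

/-- A prime ideal: proper, and `x ∧ y ∈ P` implies `x ∈ P` or `y ∈ P`. -/
def IsPrime (P : MVIdeal A) : Prop :=
  P.carrier ≠ Set.univ ∧ ∀ x y : A, meet x y ∈ P.carrier → x ∈ P.carrier ∨ y ∈ P.carrier

/-- A maximal ideal: maximal for inclusion among the proper ideals. -/
def IsMaximal (M : MVIdeal A) : Prop :=
  M.carrier ≠ Set.univ ∧
    ∀ J : MVIdeal A, J.carrier ≠ Set.univ → M.carrier ⊆ J.carrier → J.carrier = M.carrier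

variable (A) in
/-- The prime spectrum `Spec(A)`. -/
def Spec : Set (MVIdeal A) := {P | P.IsPrime}

/-- `V(I) = {P ∈ Spec(A) | I ⊆ P}`. -/
def V (I : Set A) : Set (MVIdeal A) := {P | P ∈ Spec A ∧ I ⊆ P.carrier}

theorem zero_mem (I : MVIdeal A) : (0 : A) ∈ I.carrier := by
  obtain ⟨x, hx⟩ := I.nonempty
  exact I.mem_of_le hx (le_iff_exists.2 ⟨x, (zero_add x).symm⟩)

/-- The congruence of an ideal: `x ~ y` iff `d(x, y) ∈ I`. -/
def setoid (I : MVIdeal A) : Setoid A where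
  r x y := mvDist x y ∈ I.carrier
  iseqv :=
    { refl := fun x => by rw [mvDist_self]; exact I.zero_mem
      symm := fun {x y} h => by rw [mvDist_comm]; exact h
      trans := fun {x y z} h h' => I.mem_of_le (I.add_mem h h') (mvDist_triangle x y z) }

/-- The quotient `A / I`. -/
def Quot (I : MVIdeal A) : Type u := Quotient I.setoid

/-- The canonical projection `A → A / I`. -/
def proj (I : MVIdeal A) (x : A) : I.Quot := Quotient.mk I.setoid x

instance (I : MVIdeal A) : Zero I.Quot := ⟨I.proj 0⟩

instance (I : MVIdeal A) : Add I.Quot :=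
  ⟨Quotient.map₂ (fun x y => x + y) (fun x x' h y y' h' =>
    I.mem_of_le (I.add_mem h h') (mvDist_add_add x x' y y'))⟩

/-- The MV-algebra structure on `A / I`, with the operations induced by those of `A`. -/
instance (I : MVIdeal A) : MVAlgebra I.Quot where
  neg := Quotient.map neg (fun x x' h => by
    change mvDist (neg x) (neg x') ∈ I.carrier
    rw [mvDist_neg_neg]
    exact h)
  nsmul := nsmulRec
  add_assoc := by
    rintro ⟨x⟩ ⟨y⟩ ⟨z⟩
    exact congrArg I.proj (add_assoc x y z)
  zero_add := by
    rintro ⟨x⟩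
    exact congrArg I.proj (zero_add x)
  add_zero := by
    rintro ⟨x⟩
    exact congrArg I.proj (add_zero x)
  add_comm := by
    rintro ⟨x⟩ ⟨y⟩
    exact congrArg I.proj (add_comm x y)
  neg_neg := by
    rintro ⟨x⟩
    exact congrArg I.proj (MVAlgebra.neg_neg x)
  add_neg_zero := by
    rintro ⟨x⟩
    exact congrArg I.proj (MVAlgebra.add_neg_zero x)
  luk := by
    rintro ⟨x⟩ ⟨y⟩
    exact congrArg I.proj (MVAlgebra.luk x y)

/-- A supermaximal ideal: a maximal ideal `M` with `A / M = {0, 1}`. -/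
def IsSupermaximal (M : MVIdeal A) : Prop :=
  M.IsMaximal ∧ (Set.univ : Set M.Quot) = {0, 1}

/-- A perfect ideal: an ideal `I` such that `A / I` is a perfect MV-algebra. -/
def IsPerfect (I : MVIdeal A) : Prop := MVAlgebra.IsPerfect I.Quot

end MVIdeal

/-- Terms in the signature `(⊕, 0, ¬)` with variables in `X`. -/
inductive MVTerm (X : Type u) : Type u
  | var : X → MVTerm X
  | zero : MVTerm X
  | add : MVTerm X → MVTerm X → MVTerm X
  | neg : MVTerm X → MVTerm X

namespace MVTerm

/-- The value of a term in an MV-algebra under an assignment of the variables. -/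
def eval {X : Type v} {A : Type u} [MVAlgebra A] (ρ : X → A) : MVTerm X → A
  | var x => ρ x
  | zero => 0
  | add s t => eval ρ s + eval ρ t
  | neg t => MVAlgebra.neg (eval ρ t)

/-- The least congruence on terms that contains all instances of the MV-algebra axioms. -/
inductive Rel (X : Type u) : MVTerm X → MVTerm X → Prop
  | refl (s) : Rel X s s
  | symm {s t} : Rel X s t → Rel X t s
  | trans {s t r} : Rel X s t → Rel X t r → Rel X s r
  | add_congr {s s' t t'} : Rel X s s' → Rel X t t' → Rel X (add s t) (add s' t')
  | neg_congr {s s'} : Rel X s s' → Rel X (neg s) (neg s')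
  | add_assoc (s t r) : Rel X (add (add s t) r) (add s (add t r))
  | add_comm (s t) : Rel X (add s t) (add t s)
  | add_zero (s) : Rel X (add s zero) s
  | neg_neg (s) : Rel X (neg (neg s)) s
  | add_neg_zero (s) : Rel X (add s (neg zero)) (neg zero)
  | luk (s t) : Rel X (add (neg (add (neg s) t)) t) (add (neg (add (neg t) s)) s)

/-- `Rel` as a setoid. -/
def relSetoid (X : Type u) : Setoid (MVTerm X) := ⟨Rel X, Rel.refl, Rel.symm, Rel.trans⟩

end MVTerm

/-- The free MV-algebra over the set `X` of generators: terms modulo the MV-algebra axioms. -/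
def FreeMV (X : Type u) : Type u := Quotient (MVTerm.relSetoid X)

namespace FreeMV

variable {X : Type u}

/-- The class of a term. -/
def mk (t : MVTerm X) : FreeMV X := Quotient.mk (MVTerm.relSetoid X) t

/-- The free generators. -/
def of (x : X) : FreeMV X := mk (MVTerm.var x)

instance : Zero (FreeMV X) := ⟨mk MVTerm.zero⟩

instance : Add (FreeMV X) :=
  ⟨Quotient.map₂ MVTerm.add (fun _ _ h _ _ h' => MVTerm.Rel.add_congr h h')⟩

instance : MVAlgebra (FreeMV X) where
  neg := Quotient.map MVTerm.neg (fun _ _ h => MVTerm.Rel.neg_congr h)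
  nsmul := nsmulRec
  add_assoc := by
    rintro ⟨x⟩ ⟨y⟩ ⟨z⟩
    exact Quotient.sound (MVTerm.Rel.add_assoc x y z)
  zero_add := by
    rintro ⟨x⟩
    exact Quotient.sound ((MVTerm.Rel.add_comm _ _).trans (MVTerm.Rel.add_zero x))
  add_zero := by
    rintro ⟨x⟩
    exact Quotient.sound (MVTerm.Rel.add_zero x)
  add_comm := by
    rintro ⟨x⟩ ⟨y⟩
    exact Quotient.sound (MVTerm.Rel.add_comm x y)
  neg_neg := by
    rintro ⟨x⟩
    exact Quotient.sound (MVTerm.Rel.neg_neg x)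
  add_neg_zero := by
    rintro ⟨x⟩
    exact Quotient.sound (MVTerm.Rel.add_neg_zero x)
  luk := by
    rintro ⟨x⟩ ⟨y⟩
    exact Quotient.sound (MVTerm.Rel.luk x y)

end FreeMV

/-- The MV-algebra `A` satisfies the equation `e.1 = e.2`. -/
def SatisfiesEq (A : Type u) [MVAlgebra A] (e : MVTerm ℕ × MVTerm ℕ) : Prop :=
  ∀ ρ : ℕ → A, e.1.eval ρ = e.2.eval ρ

/-- `A` belongs to the variety `𝕍(B)` generated by `B`: it lies in every variety of
MV-algebras (that is, every class defined by a set `E` of equations) that contains `B`. -/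
def InVarietyGeneratedBy (B : Type v) [MVAlgebra B] (A : Type u) [MVAlgebra A] : Prop :=
  ∀ E : Set (MVTerm ℕ × MVTerm ℕ), (∀ e ∈ E, SatisfiesEq B e) → ∀ e ∈ E, SatisfiesEq A e

/-- The underlying set `[0, e]` of the MV-algebra `Γ(G, e)`, where `G` is a lattice ordered
abelian group and `e ≥ 0` is an element of `G`. -/
def Gam (G : Type u) [AddCommGroup G] [Lattice G] (e : G) : Type u := {a : G // 0 ≤ a ∧ a ≤ e}

/-- The MV-algebra `Γ(G, e)`: `a ⊕ b = (a + b) ∧ e`, `¬a = e - a`. -/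
@[reducible] def Gam.mvAlgebra (G : Type u) [AddCommGroup G] [Lattice G] [IsOrderedAddMonoid G] (e : G)
    (he : 0 ≤ e) : MVAlgebra (Gam G e) where
  zero := ⟨0, le_refl 0, he⟩
  add a b := ⟨(a.1 + b.1) ⊓ e, le_inf (add_nonneg a.2.1 b.2.1) he, inf_le_right⟩
  neg a := ⟨e - a.1, sub_nonneg.2 a.2.2, sub_le_self e a.2.1⟩
  nsmul := @nsmulRec _ ⟨⟨0, le_refl 0, he⟩⟩
    ⟨fun a b => ⟨(a.1 + b.1) ⊓ e, le_inf (add_nonneg a.2.1 b.2.1) he, inf_le_right⟩⟩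
  add_assoc := by
    rintro ⟨a, ha⟩ ⟨b, hb⟩ ⟨c, hc⟩
    apply Subtype.ext
    change ((a + b) ⊓ e + c) ⊓ e = (a + (b + c) ⊓ e) ⊓ e
    rw [inf_add, add_inf, inf_assoc, inf_assoc, inf_eq_right.2 (le_add_of_nonneg_right hc.1),
      inf_eq_right.2 (le_add_of_nonneg_left ha.1), add_assoc]
  zero_add := by
    rintro ⟨a, ha⟩
    apply Subtype.ext
    change (0 + a) ⊓ e = a
    rw [zero_add, inf_eq_left.2 ha.2]
  add_zero := by
    rintro ⟨a, ha⟩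
    apply Subtype.ext
    change (a + 0) ⊓ e = a
    rw [add_zero, inf_eq_left.2 ha.2]
  add_comm := by
    rintro ⟨a, ha⟩ ⟨b, hb⟩
    apply Subtype.ext
    change (a + b) ⊓ e = (b + a) ⊓ e
    rw [add_comm]
  neg_neg := by
    rintro ⟨a, ha⟩
    apply Subtype.ext
    change e - (e - a) = a
    abel
  add_neg_zero := by
    rintro ⟨a, ha⟩
    apply Subtype.ext
    change (a + (e - 0)) ⊓ e = e - 0
    rw [sub_zero, inf_eq_right.2 (le_add_of_nonneg_left ha.1)]
  luk := by
    rintro ⟨a, ha⟩ ⟨b, hb⟩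
    apply Subtype.ext
    change (e - ((e - a + b) ⊓ e) + b) ⊓ e = (e - ((e - b + a) ⊓ e) + a) ⊓ e
    have key : ∀ x y : G, e - ((e - x + y) ⊓ e) + y = x ⊔ y := by
      intro x y
      rw [sub_eq_add_neg, neg_inf, add_sup, sup_add]
      congr 1 <;> abel
    rw [key, key, sup_comm]

/-- The Chang algebra `C = K₁ = Γ(ℤ lex ℤ, (1, 0))`. -/
abbrev Chang : Type := Gam (ℤ ×ₗ ℤ) (toLex (1, 0))

instance Chang.instMVAlgebra : MVAlgebra Chang :=
  Gam.mvAlgebra (ℤ ×ₗ ℤ) (toLex (1, 0)) (by decide)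

/-! The proof runs 1 → 2 → 3 → 1, together with 3 ↔ 4.

1 → 2: in the Chang algebra `z = x ∧ ¬x` is infinitesimal, that is, `n z ≤ ¬z` for all `n`. These
are equations, so they hold in `A`, and they force `z` into every maximal ideal. Maximal ideals are
prime, so each contains `x` or `¬x`.

2 → 3: modulo a prime ideal `P` the order is total, so `2x` or `2¬x` is `1`. Not both `x` and `¬x`
have finite order, since one of them lies in a maximal ideal above `P`.

3 → 1: an equation that fails in `A` fails modulo some prime ideal (`exists_isMaximalAvoiding`),
hence in a perfect chain. The infinite order elements of such a chain form the positive cone of an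
ordered group `G`, and the chain embeds in `Γ(ℤ ×ₗ G, (1, 0))` (`isLexRepresentation`). A failure
there involves finitely many sign conditions on integral linear forms, which a Farkas argument
(`exists_hom_nonneg_neg`) realizes with `ℤ` in place of `G`, that is, in the Chang algebra.

3 ↔ 4 is the correspondence between primes of a quotient and primes above the ideal. -/

namespace MVAlgebra

/-! ### Order, residuation and prelinearity in MV-algebras. -/

variable {A : Type u} [MVAlgebra A]

theorem neg_one' : neg (1 : A) = 0 := neg_neg 0

theorem le_antisymm' {x y : A} (h : le x y) (h' : le y x) : x = y := by
  unfold le join at h h'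
  rw [← h, luk, h']

theorem zero_le' (x : A) : le 0 x := le_iff_exists.2 ⟨x, (zero_add x).symm⟩

theorem le_one' (x : A) : le x 1 := by
  rw [le_iff, one_def, add_neg_zero]

theorem eq_zero_of_le {x : A} (h : le x 0) : x = 0 := le_antisymm' h (zero_le' x)

theorem le_add_left' (x y : A) : le x (y + x) := le_iff_exists.2 ⟨y, add_comm _ _⟩

theorem le_add_right' (x y : A) : le x (x + y) := le_iff_exists.2 ⟨y, rfl⟩

theorem neg_le_neg' {x y : A} (h : le x y) : le (neg y) (neg x) := by
  rw [le_iff] at h ⊢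
  rw [neg_neg, add_comm, h]

theorem diff_le_left (x y : A) : le (diff x y) x :=
  le_add_of_diff_le.2 (le_add_right' x y)

theorem diff_eq_zero {x y : A} : diff x y = 0 ↔ le x y := by
  rw [le_iff, diff]
  constructor
  · intro h
    rw [← neg_neg (neg x + y), h, one_def]
  · intro h
    rw [h, neg_one']

theorem diff_zero_right (x : A) : diff x 0 = x := by
  rw [diff, add_zero, neg_neg]

theorem mvDist_zero_right (x : A) : mvDist x 0 = x := by
  rw [mvDist, diff_zero_right, diff_eq_zero.2 (zero_le' x), add_zero]

theorem eq_of_mvDist_eq_zero {x y : A} (h : mvDist x y = 0) : x = y := by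
  apply le_antisymm'
  · rw [← diff_eq_zero]
    apply eq_zero_of_le
    rw [← h]
    exact le_add_right' _ _
  · rw [← diff_eq_zero]
    apply eq_zero_of_le
    rw [← h]
    exact le_add_left' _ _

theorem diff_add_cancel {x y : A} (h : le y x) : diff x y + y = x := by
  unfold diff
  rw [luk]
  exact h

theorem meet_eq_diff_diff (x y : A) : meet x y = diff x (diff x y) := by
  rw [meet, join, luk, neg_neg y, diff, diff, add_comm, add_comm y]

theorem meet_comm (x y : A) : meet x y = meet y x := by
  unfold meet join
  rw [luk]

theorem meet_le_left (x y : A) : le (meet x y) x := by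
  rw [meet_eq_diff_diff]
  exact diff_le_left _ _

theorem meet_le_right (x y : A) : le (meet x y) y := by
  rw [meet_comm]
  exact meet_le_left _ _

theorem diff_anti_right {x y z : A} (h : le y z) : le (diff x z) (diff x y) :=
  le_add_of_diff_le.2 (le_trans' (le_diff_add x y) (add_le_add' (le_self _) h))

/-- The map `y ↦ x ⊖ y` reverses order and is an involution on `[0, x]`; applied twice it carries `z
≤ y` to `z ≤ x ∧ y`. -/
theorem le_meet {x y z : A} (h : le z x) (h' : le z y) : le z (meet x y) := by
  have hz : diff x (diff x z) = z := by
    rw [← meet_eq_diff_diff, meet_comm, meet_eq_diff_diff, diff_eq_zero.2 h, diff_zero_right]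
  rw [meet_eq_diff_diff, ← hz]
  exact diff_anti_right (diff_anti_right h')

/-- By residuation both hypotheses bound `w ⊖ z`, so the claim reduces to `le_meet`. -/
theorem le_add_meet {x y z w : A} (h : le w (z + x)) (h' : le w (z + y)) :
    le w (z + meet x y) := by
  rw [add_comm] at h h' ⊢
  rw [← le_add_of_diff_le] at h h' ⊢
  exact le_meet h h'

theorem meet_add_le (x y z : A) : le (meet (x + y) z) (meet x z + meet y z) := by
  have h1 : le (meet (x + y) z) (y + meet x z) := by
    apply le_add_meet
    · rw [add_comm y]
      exact meet_le_left _ _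
    · exact le_trans' (meet_le_right _ _) (le_add_left' _ _)
  apply le_add_meet
  · rw [add_comm (meet x z)]
    exact h1
  · exact le_trans' (meet_le_right _ _) (le_add_left' _ _)

/-- If `y ≤ ¬x`, then `x + y` is a cancellable sum. -/
theorem diff_add_of_le_neg {x y : A} (h : le y (neg x)) : diff (x + y) y = x := by
  unfold diff
  have h' := h
  unfold le at h'
  rw [join, luk, neg_neg] at h'
  rw [h', neg_neg]

/-- Prelinearity. -/
theorem meet_diff_diff (x y : A) : meet (diff x y) (diff y x) = 0 := by
  -- `w + m` lies below both `x` and `y`, hence below `m`. The sum is cancellable because `m ≤ ¬w`,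
  -- so `w = (w + m) ⊖ m = 0`.
  set w := meet (diff x y) (diff y x) with hw
  set m := meet x y with hm
  have hx : le (w + m) x := by
    have h := diff_add_cancel (diff_le_left x y)
    rw [← meet_eq_diff_diff, ← hm, add_comm] at h
    have h' := add_le_add' (meet_le_left (diff x y) (diff y x)) (le_self m)
    rwa [h] at h'
  have hy : le (w + m) y := by
    have h := diff_add_cancel (diff_le_left y x)
    rw [← meet_eq_diff_diff, meet_comm, ← hm, add_comm] at h
    have h' := add_le_add' (meet_le_right (diff x y) (diff y x)) (le_self m)
    rwa [h] at h'
  have hwm : le m (neg w) := by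
    rw [← neg_neg m]
    apply neg_le_neg'
    rw [hm, meet_eq_diff_diff]
    unfold diff
    rw [neg_neg]
    exact le_trans' (meet_le_left _ _) (le_add_left' _ _)
  rw [← diff_add_of_le_neg hwm]
  exact diff_eq_zero.2 (le_meet hx hy)

theorem nsmul_le_nsmul' {x y : A} (h : le x y) (n : ℕ) : le (n • x) (n • y) := by
  induction n with
  | zero => rw [zero_nsmul, zero_nsmul]; exact le_self _
  | succ n ih => rw [succ_nsmul, succ_nsmul]; exact add_le_add' ih h

theorem eq_one_of_le {x : A} (h : le 1 x) : x = 1 := le_antisymm' (le_one' x) h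

theorem HasFiniteOrder.mono {x y : A} (hx : HasFiniteOrder x) (h : le x y) :
    HasFiniteOrder y := by
  obtain ⟨n, hn⟩ := hx
  refine ⟨n, eq_one_of_le ?_⟩
  rw [← hn]
  exact nsmul_le_nsmul' h n

theorem hasFiniteOrder_one : HasFiniteOrder (1 : A) := ⟨1, one_nsmul _⟩

end MVAlgebra

/-! ### Quotients, generated ideals, and separation by prime ideals. -/

namespace MVIdeal

open MVAlgebra

variable {A : Type u} [MVAlgebra A]

theorem nsmul_mem (I : MVIdeal A) {x : A} (hx : x ∈ I.carrier) (n : ℕ) : n • x ∈ I.carrier := by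
  induction n with
  | zero => rw [zero_nsmul]; exact I.zero_mem
  | succ n ih => rw [succ_nsmul]; exact I.add_mem ih hx

theorem carrier_eq_univ_iff (I : MVIdeal A) : I.carrier = Set.univ ↔ (1 : A) ∈ I.carrier :=
  ⟨fun h => h ▸ Set.mem_univ _, fun h => Set.eq_univ_of_forall fun x => I.mem_of_le h (le_one' x)⟩

theorem proj_eq_iff (I : MVIdeal A) {x y : A} : I.proj x = I.proj y ↔ mvDist x y ∈ I.carrier :=
  Quotient.eq (r := I.setoid)

theorem proj_surjective (I : MVIdeal A) : Function.Surjective I.proj := Quotient.exists_rep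

theorem proj_zero (I : MVIdeal A) : I.proj 0 = 0 := rfl

theorem proj_one (I : MVIdeal A) : I.proj 1 = 1 := rfl

theorem proj_add (I : MVIdeal A) (x y : A) : I.proj (x + y) = I.proj x + I.proj y := rfl

theorem proj_neg (I : MVIdeal A) (x : A) : I.proj (neg x) = neg (I.proj x) := rfl

theorem proj_meet (I : MVIdeal A) (x y : A) : I.proj (meet x y) = meet (I.proj x) (I.proj y) := rfl

theorem proj_nsmul (I : MVIdeal A) (n : ℕ) (x : A) : I.proj (n • x) = n • I.proj x := by
  induction n with
  | zero => rw [zero_nsmul, zero_nsmul, proj_zero]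
  | succ n ih => rw [succ_nsmul, succ_nsmul, proj_add, ih]

theorem proj_eq_zero_iff (I : MVIdeal A) {x : A} : I.proj x = 0 ↔ x ∈ I.carrier := by
  rw [← proj_zero, proj_eq_iff, mvDist_zero_right]

theorem proj_eq_one_iff (I : MVIdeal A) {x : A} : I.proj x = 1 ↔ neg x ∈ I.carrier := by
  rw [← proj_eq_zero_iff, proj_neg]
  constructor
  · intro h
    rw [h, neg_one']
  · intro h
    rw [← MVAlgebra.neg_neg (I.proj x), h, one_def]

theorem proj_le_iff (I : MVIdeal A) {x y : A} :
    le (I.proj x) (I.proj y) ↔ diff x y ∈ I.carrier := by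
  rw [← diff_eq_zero, ← proj_eq_zero_iff]
  rfl

theorem hasFiniteOrder_proj_iff (I : MVIdeal A) {x : A} :
    HasFiniteOrder (I.proj x) ↔ ∃ n : ℕ, neg (n • x) ∈ I.carrier := by
  simp only [HasFiniteOrder, ← proj_nsmul, proj_eq_one_iff]

theorem isPerfect_iff (I : MVIdeal A) :
    I.IsPerfect ↔ ∀ x : A, Xor (∃ n : ℕ, neg (n • x) ∈ I.carrier)
      (∃ n : ℕ, neg (n • neg x) ∈ I.carrier) := by
  simp only [← hasFiniteOrder_proj_iff, proj_neg]
  exact I.proj_surjective.forall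

/-- The ideal generated by `I` and `x`. -/
def adjoin (I : MVIdeal A) (x : A) : MVIdeal A where
  carrier := {z | ∃ p ∈ I.carrier, ∃ n : ℕ, le z (p + n • x)}
  nonempty := ⟨0, 0, I.zero_mem, 0, zero_le' _⟩
  add_mem := by
    rintro a b ⟨p, hp, n, h⟩ ⟨q, hq, m, h'⟩
    refine ⟨p + q, I.add_mem hp hq, n + m, ?_⟩
    rw [add_nsmul, add_add_add_comm]
    exact add_le_add' h h'
  mem_of_le := by
    rintro a b ⟨p, hp, n, h⟩ h'
    exact ⟨p, hp, n, le_trans' h' h⟩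

theorem subset_adjoin (I : MVIdeal A) (x : A) : I.carrier ⊆ (I.adjoin x).carrier :=
  fun p hp => ⟨p, hp, 0, le_add_right' _ _⟩

theorem mem_adjoin_self (I : MVIdeal A) (x : A) : x ∈ (I.adjoin x).carrier := by
  refine ⟨0, I.zero_mem, 1, ?_⟩
  rw [zero_add, one_nsmul]
  exact le_self _

/-- `M` is maximal among the ideals that do not contain `d`. -/
def IsMaximalAvoiding (M : MVIdeal A) (d : A) : Prop :=
  d ∉ M.carrier ∧ ∀ J : MVIdeal A, d ∉ J.carrier → M.carrier ⊆ J.carrier → J.carrier = M.carrier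

theorem isMaximal_iff (M : MVIdeal A) : M.IsMaximal ↔ M.IsMaximalAvoiding 1 := by
  simp only [IsMaximal, IsMaximalAvoiding, ne_eq, carrier_eq_univ_iff]

theorem IsMaximalAvoiding.mem_adjoin {M : MVIdeal A} {d : A} (hM : M.IsMaximalAvoiding d) {x : A}
    (hx : x ∉ M.carrier) : d ∈ (M.adjoin x).carrier := by
  by_contra h
  have := hM.2 _ h (M.subset_adjoin x)
  exact hx (this ▸ M.mem_adjoin_self x)

theorem nsmul_meet_mem (I : MVIdeal A) {x y : A} (h : meet x y ∈ I.carrier) (n : ℕ) :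
    meet (n • x) y ∈ I.carrier := by
  induction n with
  | zero =>
    rw [zero_nsmul]
    exact I.mem_of_le I.zero_mem (meet_le_left _ _)
  | succ n ih =>
    rw [succ_nsmul]
    exact I.mem_of_le (I.add_mem ih h) (meet_add_le _ _ _)

/-- If `x` and `y` are both outside `M`, then `d ≤ p + n x` and `d ≤ q + m y` with `p, q ∈ M`, so `d
≤ (p + q) + (n x ∧ m y)`. The last meet is in `M` as soon as `x ∧ y` is, which would put `d` in `M`.
-/
theorem IsMaximalAvoiding.isPrime {M : MVIdeal A} {d : A} (hM : M.IsMaximalAvoiding d) :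
    M.IsPrime := by
  refine ⟨fun h => hM.1 (h ▸ Set.mem_univ d), fun x y hxy => ?_⟩
  by_contra! h
  obtain ⟨p, hp, n, hn⟩ := hM.mem_adjoin h.1
  obtain ⟨q, hq, m, hm⟩ := hM.mem_adjoin h.2
  have h1 : meet (n • x) (m • y) ∈ M.carrier := by
    have := M.nsmul_meet_mem hxy n
    rw [meet_comm] at this ⊢
    exact M.nsmul_meet_mem this m
  refine hM.1 (M.mem_of_le (M.add_mem (M.add_mem hp hq) h1) (le_add_meet ?_ ?_))
  · exact le_trans' hn (add_le_add' (le_add_right' _ _) (le_self _))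
  · exact le_trans' hm (add_le_add' (le_add_left' _ _) (le_self _))

theorem exists_isMaximalAvoiding (I : MVIdeal A) {d : A} (hd : d ∉ I.carrier) :
    ∃ M : MVIdeal A, I.carrier ⊆ M.carrier ∧ M.IsMaximalAvoiding d := by
  obtain ⟨S, hIS, hS⟩ := zorn_subset_nonempty
    {S : Set A | ∃ J : MVIdeal A, J.carrier = S ∧ d ∉ S} (by
      intro c hc hchain hne
      have hdir : ∀ s ∈ c, ∀ t ∈ c, ∃ r ∈ c, s ⊆ r ∧ t ⊆ r := by
        intro s hs t ht
        rcases hchain.total hs ht with h | h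
        · exact ⟨t, ht, h, subset_rfl⟩
        · exact ⟨s, hs, subset_rfl, h⟩
      refine ⟨⋃₀ c, ⟨⟨⋃₀ c, ?_, ?_, ?_⟩, rfl, ?_⟩, fun s hs => Set.subset_sUnion_of_mem hs⟩
      · obtain ⟨s, hs⟩ := hne
        obtain ⟨J, rfl, -⟩ := hc hs
        exact ⟨0, _, hs, J.zero_mem⟩
      · rintro x y ⟨s, hs, hx⟩ ⟨t, ht, hy⟩
        obtain ⟨r, hr, hsr, htr⟩ := hdir s hs t ht
        obtain ⟨J, rfl, -⟩ := hc hr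
        exact ⟨_, hr, J.add_mem (hsr hx) (htr hy)⟩
      · rintro x y ⟨s, hs, hx⟩ hyx
        obtain ⟨J, rfl, -⟩ := hc hs
        exact ⟨_, hs, J.mem_of_le hx hyx⟩
      · rintro ⟨s, hs, hds⟩
        obtain ⟨J, -, h⟩ := hc hs
        exact h hds) I.carrier ⟨I, rfl, hd⟩
  obtain ⟨⟨M, rfl, hdM⟩, hmax⟩ := hS
  exact ⟨M, hIS, hdM, fun J hJ hMJ => (hmax ⟨J, rfl, hJ⟩ hMJ).antisymm hMJ⟩

/-- Prelinearity: `(x ⊖ y) ∧ (y ⊖ x) = 0` lies in `P`, so one of the two differences does. -/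
theorem IsPrime.le_total {P : MVIdeal A} (hP : P.IsPrime) (x y : P.Quot) : le x y ∨ le y x := by
  obtain ⟨x, rfl⟩ := P.proj_surjective x
  obtain ⟨y, rfl⟩ := P.proj_surjective y
  rw [proj_le_iff, proj_le_iff]
  apply hP.2
  rw [meet_diff_diff]
  exact P.zero_mem

end MVIdeal

/-! ### Separation of integral linear forms. -/

/-- Farkas' lemma in terms of a positive cone: finitely many integral linear forms whose signs
come from values in a linearly ordered group can be separated by an integral point. -/
theorem exists_hom_nonneg_neg {ι G : Type*} [AddCommGroup G] [LinearOrder G]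
    [IsOrderedAddMonoid G] (γ : (ι →₀ ℤ) →+ G) (T : List (ι →₀ ℤ)) (b : ι →₀ ℤ)
    (hT : ∀ a ∈ T, 0 ≤ γ a) (hb : γ b < 0) :
    ∃ f : (ι →₀ ℤ) →+ ℤ, (∀ a ∈ T, 0 ≤ f a) ∧ f b < 0 := by
  induction hn : T.length generalizing T b with
  | zero =>
    obtain rfl := List.length_eq_zero_iff.1 hn
    obtain ⟨i, hi⟩ : ∃ i, b i ≠ 0 := by
      by_contra! h
      rw [show b = 0 from Finsupp.ext h, map_zero] at hb
      exact lt_irrefl _ hb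
    rcases hi.lt_or_gt with h | h
    · exact ⟨Finsupp.applyAddHom i, by simp, h⟩
    · exact ⟨-Finsupp.applyAddHom i, by simp, neg_lt_zero.2 h⟩
  | succ n ih =>
    obtain ⟨c, T, rfl⟩ := List.exists_cons_of_length_eq_add_one hn
    have hlen : T.length = n := by simpa using hn
    obtain ⟨f, hf, hfb⟩ := ih T b (fun a ha => hT a (List.mem_cons_of_mem _ ha)) hb hlen
    have hc := hT c List.mem_cons_self
    rcases le_or_gt 0 (f c) with h | h
    · refine ⟨f, fun a ha => ?_, hfb⟩
      rcases List.mem_cons.1 ha with rfl | ha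
      · exact h
      · exact hf a ha
    -- When `f c < 0`, project along `c` into the kernel of `f` by `a ↦ (-f c) a + (f a) c`. The
    -- signs of `f` on `T`, `b` and `c` preserve the sign hypotheses on `γ`.
    · have hT' : ∀ a ∈ T.map fun a => (-f c) • a + f a • c, 0 ≤ γ a := by
        intro u hu
        obtain ⟨a, ha, rfl⟩ := List.mem_map.1 hu
        rw [map_add, map_zsmul, map_zsmul]
        exact add_nonneg (zsmul_nonneg (hT a (List.mem_cons_of_mem _ ha)) (neg_nonneg.2 h.le))
          (zsmul_nonneg hc (hf a ha))
      have hb' : γ ((-f c) • b + f b • c) < 0 := by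
        rw [map_add, map_zsmul, map_zsmul]
        refine add_neg_of_neg_of_nonpos ?_ ?_
        · rw [← neg_pos, ← smul_neg]
          exact zsmul_pos (neg_pos.2 hb) (neg_pos.2 h)
        · rw [← neg_nonneg, ← neg_smul]
          exact zsmul_nonneg hc (neg_nonneg.2 hfb.le)
      obtain ⟨g, hg, hgb⟩ := ih _ _ hT' hb' (by simpa using hlen)
      -- This form is `g` composed with the projection: it vanishes at `c` and takes the required
      -- signs elsewhere.
      refine ⟨(-f c) • g + g c • f, fun a ha => ?_, ?_⟩
      · rcases List.mem_cons.1 ha with rfl | ha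
        · simp [mul_comm]
        · have := hg _ (List.mem_map_of_mem ha)
          simp only [map_add, map_zsmul, AddMonoidHom.add_apply, AddMonoidHom.smul_apply,
            smul_eq_mul] at this ⊢
          linarith
      · simp only [map_add, map_zsmul, AddMonoidHom.add_apply, AddMonoidHom.smul_apply,
          smul_eq_mul] at hgb ⊢
        linarith

/-! ### Lexicographic representations and transfer of equations from the Chang algebra. -/

open MVAlgebra

/-- A map `j` from an MV-algebra to `ℤ ×ₗ G` that represents it inside `Γ(ℤ ×ₗ G, (1, 0))`. -/
structure IsLexRepresentation {B G : Type*} [MVAlgebra B] [AddCommGroup G] [LinearOrder G]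
    (j : B → ℤ ×ₗ G) : Prop where
  nonneg : ∀ x, 0 ≤ j x
  le_unit : ∀ x, j x ≤ toLex (1, 0)
  map_zero : j 0 = 0
  map_add : ∀ x y, j (x + y) = min (j x + j y) (toLex (1, 0))
  map_neg : ∀ x, j (neg x) = toLex (1, 0) - j x
  injective : Function.Injective j

theorem Chang.val_add (x y : Chang) : (x + y).1 = min (x.1 + y.1) (toLex (1, 0)) := rfl

theorem Chang.val_neg (x : Chang) : (neg x).1 = toLex (1, 0) - x.1 := rfl

namespace IsLexRepresentation

variable {B G : Type*} [MVAlgebra B] [AddCommGroup G] [LinearOrder G]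
  {j : B → ℤ ×ₗ G}

theorem mem_cases (hj : IsLexRepresentation j) (x : B) :
    (∃ a, 0 ≤ a ∧ j x = toLex (0, a)) ∨ ∃ a, a ≤ 0 ∧ j x = toLex (1, a) := by
  have h0 := hj.nonneg x
  have h1 := hj.le_unit x
  obtain ⟨⟨m, a⟩, hp⟩ := toLex.surjective (j x)
  rw [← hp] at h0 h1 ⊢
  rw [← toLex_zero, Prod.Lex.toLex_le_toLex] at h0
  rw [Prod.Lex.toLex_le_toLex] at h1
  simp only [Prod.fst_zero, Prod.snd_zero] at h0 h1
  rcases (show m = 0 ∨ m = 1 by omega) with rfl | rfl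
  · left; exact ⟨a, by simpa using h0, rfl⟩
  · right; exact ⟨a, by simpa using h1, rfl⟩

/-- The assignment in the Chang algebra with given first coordinates and with second coordinates
given by `f`. -/
noncomputable def changAssignment (μ : ℕ → ℤ) (f : (ℕ →₀ ℤ) →+ ℤ) (x : ℕ) : Chang :=
  open Classical in
  -- The value `0` is only a default: the inequalities that `exists_form` collects place the values
  -- of all variables of the term in the interval.
  if h : 0 ≤ toLex (μ x, f (Finsupp.single x 1)) ∧
    toLex (μ x, f (Finsupp.single x 1)) ≤ toLex ((1 : ℤ), (0 : ℤ)) then ⟨_, h⟩ else 0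

theorem changAssignment_val {μ : ℕ → ℤ} {f : (ℕ →₀ ℤ) →+ ℤ} {x : ℕ}
    (h0 : 0 ≤ toLex (μ x, f (Finsupp.single x 1)))
    (h1 : toLex (μ x, f (Finsupp.single x 1)) ≤ toLex ((1 : ℤ), (0 : ℤ))) :
    (changAssignment μ f x).1 = toLex (μ x, f (Finsupp.single x 1)) := by
  classical
  exact congrArg Subtype.val (dif_pos ⟨h0, h1⟩)

theorem lex_add {G : Type*} [AddCommGroup G] (m n : ℤ) (a b : G) :
    (toLex (m, a) + toLex (n, b) : ℤ ×ₗ G) = toLex (m + n, a + b) := rfl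

theorem lex_sub {G : Type*} [AddCommGroup G] (m n : ℤ) (a b : G) :
    (toLex (m, a) - toLex (n, b) : ℤ ×ₗ G) = toLex (m - n, a - b) := rfl

/-- Terms evaluate symbolically: the value of a term is given by a linear form in the second
coordinates of the variables, and the same form computes the value in the Chang algebra at
every integral point that satisfies finitely many linear inequalities. -/
theorem exists_form [IsOrderedAddMonoid G] (hj : IsLexRepresentation j) (ρ : ℕ → B) (t : MVTerm ℕ) :
    ∃ (T : List (ℕ →₀ ℤ)) (m : ℤ) (l : ℕ →₀ ℤ),
      (∀ a ∈ T, 0 ≤ (Finsupp.liftAddHom fun x : ℕ =>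
        (zmultiplesHom G) (ofLex (j (ρ x))).2) a) ∧
      j (t.eval ρ) = toLex (m, (Finsupp.liftAddHom fun x : ℕ =>
        (zmultiplesHom G) (ofLex (j (ρ x))).2) l) ∧
      ∀ f : (ℕ →₀ ℤ) →+ ℤ, (∀ a ∈ T, 0 ≤ f a) →
        (t.eval (changAssignment (fun x => (ofLex (j (ρ x))).1) f)).1 = toLex (m, f l) := by
  set γ : (ℕ →₀ ℤ) →+ G := Finsupp.liftAddHom fun x : ℕ =>
        (zmultiplesHom G) (ofLex (j (ρ x))).2 with hγ
  have hγx : ∀ x, γ (Finsupp.single x 1) = (ofLex (j (ρ x))).2 := by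
    intro x
    rw [hγ]
    simp
  induction t with
  | var x =>
    -- The first coordinate is `0` or `1`, and the interval then requires only that the second be
    -- nonnegative, respectively nonpositive; this is the recorded inequality.
    rcases hj.mem_cases (ρ x) with ⟨a, ha, hx⟩ | ⟨a, ha, hx⟩
    · refine ⟨[Finsupp.single x 1], 0, Finsupp.single x 1, ?_, ?_, ?_⟩
      · simp [hγx, hx, ha]
      · rw [hγx, MVTerm.eval, hx, ofLex_toLex]
      · intro f hf
        have hf' := hf _ List.mem_cons_self
        rw [MVTerm.eval, changAssignment_val] <;> rw [hx]
        · rfl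
        · rw [← toLex_zero, Prod.Lex.toLex_le_toLex]
          exact Or.inr ⟨rfl, hf'⟩
        · rw [Prod.Lex.toLex_le_toLex]
          exact Or.inl one_pos
    · refine ⟨[-Finsupp.single x 1], 1, Finsupp.single x 1, ?_, ?_, ?_⟩
      · simp [hγx, hx, ha]
      · rw [hγx, MVTerm.eval, hx, ofLex_toLex]
      · intro f hf
        have hf' := hf _ List.mem_cons_self
        rw [_root_.map_neg, neg_nonneg] at hf'
        rw [MVTerm.eval, changAssignment_val] <;> rw [hx]
        · rfl
        · rw [← toLex_zero, Prod.Lex.toLex_le_toLex]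
          exact Or.inl one_pos
        · rw [Prod.Lex.toLex_le_toLex]
          exact Or.inr ⟨rfl, hf'⟩
  | zero =>
    refine ⟨[], 0, 0, by simp, ?_, fun f _ => ?_⟩
    · rw [MVTerm.eval, hj.map_zero, _root_.map_zero]
      rfl
    · rw [MVTerm.eval, _root_.map_zero]
      rfl
  | neg t ih =>
    obtain ⟨T, m, l, hT, ht, hf⟩ := ih
    refine ⟨T, 1 - m, -l, hT, ?_, fun f h => ?_⟩
    · rw [MVTerm.eval, hj.map_neg, ht, lex_sub, _root_.map_neg, zero_sub]
    · rw [MVTerm.eval, Chang.val_neg, hf f h, lex_sub, _root_.map_neg,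
        zero_sub]
  | add s t ihs iht =>
    obtain ⟨S, m, k, hS, hs, hfs⟩ := ihs
    obtain ⟨T, n, l, hT, ht, hft⟩ := iht
    -- It suffices to resolve the truncation `min _ (1, 0)` the same way in `G` and at all integral
    -- points satisfying extra inequalities `U`.
    have key : ∀ (U : List (ℕ →₀ ℤ)) (r : ℤ) (u : ℕ →₀ ℤ), (∀ a ∈ U, 0 ≤ γ a) →
        min (toLex (m + n, γ (k + l))) (toLex (1, 0)) = toLex (r, γ u) →
        (∀ f : (ℕ →₀ ℤ) →+ ℤ, (∀ a ∈ U, 0 ≤ f a) →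
          min (toLex (m + n, f (k + l))) (toLex (1, 0)) = toLex (r, f u)) →
        ∃ (T : List (ℕ →₀ ℤ)) (r : ℤ) (u : ℕ →₀ ℤ), (∀ a ∈ T, 0 ≤ γ a) ∧
          j ((s.add t).eval ρ) = toLex (r, γ u) ∧
          ∀ f : (ℕ →₀ ℤ) →+ ℤ, (∀ a ∈ T, 0 ≤ f a) →
            ((s.add t).eval (changAssignment (fun x => (ofLex (j (ρ x))).1) f)).1 =
              toLex (r, f u) := by
      intro U r u hU h1 h2
      refine ⟨U ++ (S ++ T), r, u, ?_, ?_, ?_⟩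
      · simp only [List.mem_append]
        rintro a (h | h | h)
        exacts [hU a h, hS a h, hT a h]
      · rw [MVTerm.eval, hj.map_add, hs, ht, lex_add, ← _root_.map_add, h1]
      · intro f hf
        simp only [List.mem_append] at hf
        rw [MVTerm.eval, Chang.val_add,
          hfs f fun a ha => hf a (Or.inr (Or.inl ha)),
          hft f fun a ha => hf a (Or.inr (Or.inr ha)), lex_add, ← _root_.map_add,
          h2 f fun a ha => hf a (Or.inl ha)]
    -- The first coordinate settles the truncation unless `m + n = 1`; then the sign of `k + l`
    -- decides and is recorded.
    rcases lt_trichotomy (m + n) 1 with h | h | h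
    · refine key [] (m + n) (k + l) (by simp) ?_ fun f _ => ?_
      · rw [min_eq_left]
        rw [Prod.Lex.toLex_le_toLex]
        exact Or.inl h
      · rw [min_eq_left]
        rw [Prod.Lex.toLex_le_toLex]
        exact Or.inl h
    · rcases le_total (γ (k + l)) 0 with h' | h'
      · refine key [-(k + l)] (m + n) (k + l) ?_ ?_ fun f hf => ?_
        · rw [List.forall_mem_singleton, _root_.map_neg, neg_nonneg]
          exact h'
        · rw [min_eq_left]
          rw [Prod.Lex.toLex_le_toLex]
          exact Or.inr ⟨h, h'⟩
        · have hf' := hf _ List.mem_cons_self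
          rw [_root_.map_neg, neg_nonneg] at hf'
          rw [min_eq_left]
          rw [Prod.Lex.toLex_le_toLex]
          exact Or.inr ⟨h, hf'⟩
      · refine key [k + l] 1 0 ?_ ?_ fun f hf => ?_
        · rwa [List.forall_mem_singleton]
        · rw [min_eq_right, _root_.map_zero]
          rw [Prod.Lex.toLex_le_toLex]
          exact Or.inr ⟨h.symm, h'⟩
        · have hf' := hf _ List.mem_cons_self
          rw [min_eq_right, _root_.map_zero]
          rw [Prod.Lex.toLex_le_toLex]
          exact Or.inr ⟨h.symm, hf'⟩
    · refine key [] 1 0 (by simp) ?_ fun f _ => ?_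
      · rw [min_eq_right, _root_.map_zero]
        rw [Prod.Lex.toLex_le_toLex]
        exact Or.inl h
      · rw [min_eq_right, _root_.map_zero]
        rw [Prod.Lex.toLex_le_toLex]
        exact Or.inl h

/-- An MV-algebra that embeds into `Γ(ℤ ×ₗ G, (1, 0))` satisfies the equations of the Chang
algebra. -/
theorem satisfiesEq [IsOrderedAddMonoid G] (hj : IsLexRepresentation j) {e : MVTerm ℕ × MVTerm ℕ}
    (he : SatisfiesEq Chang e) : SatisfiesEq B e := by
  intro ρ
  obtain ⟨S, m, k, hS, hs, hfs⟩ := hj.exists_form ρ e.1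
  obtain ⟨T, n, l, hT, ht, hft⟩ := hj.exists_form ρ e.2
  set γ : (ℕ →₀ ℤ) →+ G := Finsupp.liftAddHom fun x : ℕ =>
        (zmultiplesHom G) (ofLex (j (ρ x))).2
  have key : ∀ f : (ℕ →₀ ℤ) →+ ℤ, (∀ a ∈ S ++ T, 0 ≤ f a) → m = n ∧ f k = f l := by
    intro f hf
    have h := congrArg Subtype.val (he (changAssignment (fun x => (ofLex (j (ρ x))).1) f))
    rw [hfs f fun a ha => hf a (List.mem_append_left _ ha),
      hft f fun a ha => hf a (List.mem_append_right _ ha)] at h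
    exact Prod.ext_iff.1 (toLex.injective h)
  have hST : ∀ a ∈ S ++ T, 0 ≤ γ a := fun a ha =>
    (List.mem_append.1 ha).elim (hS a) (hT a)
  -- The zero form satisfies all the inequalities, so the first coordinates agree.
  have hmn := (key 0 (by simp)).1
  -- If `γ k` and `γ l` differed, Farkas would give an integral point of the cone with `f k ≠ f l`,
  -- against `key`.
  have main : ∀ u : ℕ →₀ ℤ, (u = k - l ∨ u = l - k) → ¬ γ u < 0 := by
    intro u hu hneg
    obtain ⟨f, hf, hfu⟩ := exists_hom_nonneg_neg γ (S ++ T) u hST hneg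
    have := (key f hf).2
    rcases hu with rfl | rfl <;> rw [map_sub] at hfu <;> omega
  have h1 := not_lt.1 (main _ (Or.inl rfl))
  have h2 := not_lt.1 (main _ (Or.inr rfl))
  rw [map_sub, sub_nonneg] at h1 h2
  apply hj.injective
  rw [hs, ht, hmn, le_antisymm h2 h1]

end IsLexRepresentation

/-! ### Perfect chains and their embedding in a lexicographic product. -/

namespace MVAlgebra

/-- A perfect MV-chain. -/
structure IsPerfectChain (B : Type u) [MVAlgebra B] : Prop where
  le_total : ∀ x y : B, le x y ∨ le y x
  perfect : IsPerfect B

namespace IsPerfectChain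

variable {B : Type u} [MVAlgebra B]

theorem neg_iff (hB : IsPerfectChain B) {x : B} :
    HasFiniteOrder (neg x) ↔ ¬ HasFiniteOrder x := by
  rcases hB.perfect x with h | h <;> tauto

theorem not_hasFiniteOrder_zero (hB : IsPerfectChain B) : ¬ HasFiniteOrder (0 : B) := by
  rw [← hB.neg_iff]
  exact hasFiniteOrder_one

/-- By totality `x + y` is at most twice the larger summand, whose multiples never reach `1`. -/
theorem not_hasFiniteOrder_add (hB : IsPerfectChain B) {x y : B} (hx : ¬ HasFiniteOrder x)
    (hy : ¬ HasFiniteOrder y) : ¬ HasFiniteOrder (x + y) := by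
  have key : ∀ {x y : B}, le x y → ¬ HasFiniteOrder y → ¬ HasFiniteOrder (x + y) := by
    intro x y h hy h'
    obtain ⟨n, hn⟩ := h'.mono (add_le_add' h (le_self y))
    exact hy ⟨n * 2, by rwa [mul_nsmul', two_nsmul]⟩
  rcases hB.le_total x y with h | h
  · exact key h hy
  · rw [add_comm]
    exact key h hx

/-- The radical of a perfect chain: the elements of infinite order. -/
def radical (hB : IsPerfectChain B) : AddSubmonoid B where
  carrier := {x | ¬ HasFiniteOrder x}
  zero_mem' := hB.not_hasFiniteOrder_zero
  add_mem' := hB.not_hasFiniteOrder_add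

variable (hB : IsPerfectChain B)

/-- Otherwise `¬y ≤ x`, and `x` would inherit finite order from `¬y`. This makes sums of radical
elements cancellable, so that the radical embeds in its Grothendieck group. -/
theorem le_neg (x y : hB.radical) : le (x : B) (neg (y : B)) := by
  rcases hB.le_total (x : B) (neg y) with h | h
  · exact h
  · exact absurd ((hB.neg_iff.2 y.2).mono h) x.2

theorem add_le_add_iff (x y z : hB.radical) :
    le (x + z : B) (y + z : B) ↔ le (x : B) y := by
  constructor
  · intro h
    rw [← le_add_of_diff_le, diff_add_of_le_neg (hB.le_neg z x)] at h
    exact h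
  · exact fun h => add_le_add' h (le_self _)

noncomputable instance : LinearOrder hB.radical where
  le x y := le (x : B) y
  le_refl x := le_self _
  le_trans _ _ _ := le_trans'
  le_antisymm _ _ h h' := Subtype.ext (le_antisymm' h h')
  le_total x y := hB.le_total x y
  toDecidableLE := Classical.decRel _

instance : IsOrderedCancelAddMonoid hB.radical where
  add_le_add_left x y h z := (hB.add_le_add_iff x y z).2 h
  le_of_add_le_add_left z x y h := by
    rw [add_comm z, add_comm z] at h
    exact (hB.add_le_add_iff x y z).1 h

/-- The ordered group whose positive cone is the radical. -/
abbrev RadicalGroup : Type u := Algebra.GrothendieckAddGroup hB.radical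

/-- The embedding of the radical. -/
noncomputable def ofRadical : hB.radical →+ hB.RadicalGroup := Algebra.GrothendieckAddGroup.of

theorem ofRadical_le_iff {x y : hB.radical} :
    hB.ofRadical x ≤ hB.ofRadical y ↔ x ≤ y := by
  change AddLocalization.mk _ _ ≤ AddLocalization.mk _ _ ↔ _
  rw [AddLocalization.mk_le_mk]
  exact add_le_add_iff_left _

theorem ofRadical_nonneg (x : hB.radical) : 0 ≤ hB.ofRadical x := by
  rw [← map_zero hB.ofRadical, ofRadical_le_iff]
  exact zero_le' (x : B)

theorem ofRadical_injective : Function.Injective hB.ofRadical := fun _ _ h =>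
  _root_.le_antisymm ((ofRadical_le_iff hB).1 h.le) ((ofRadical_le_iff hB).1 h.ge)

/-- Every element of a perfect chain lies in the radical or has its negation there. -/
theorem exists_radical (x : B) : ∃ r : hB.radical, x = r ∨ x = neg (r : B) := by
  by_cases h : HasFiniteOrder x
  · refine ⟨⟨neg x, fun h' => hB.neg_iff.1 h' h⟩, Or.inr (neg_neg x).symm⟩
  · exact ⟨⟨x, h⟩, Or.inl rfl⟩

open Classical in
/-- The representation of a perfect chain in `ℤ ×ₗ G`. -/
noncomputable def toLexGroup (x : B) : ℤ ×ₗ hB.RadicalGroup :=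
  if h : HasFiniteOrder x then toLex (1, -hB.ofRadical ⟨neg x, fun h' => hB.neg_iff.1 h' h⟩)
  else toLex (0, hB.ofRadical ⟨x, h⟩)

theorem toLexGroup_coe (r : hB.radical) :
    hB.toLexGroup (r : B) = toLex (0, hB.ofRadical r) :=
  dif_neg r.2

theorem toLexGroup_neg (r : hB.radical) :
    hB.toLexGroup (neg (r : B)) = toLex (1, -hB.ofRadical r) := by
  refine (dif_pos (hB.neg_iff.2 r.2)).trans ?_
  congr 4
  exact Subtype.ext (neg_neg _)

theorem toLexGroup_coe_le (r : hB.radical) :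
    (toLex (0, hB.ofRadical r) : ℤ ×ₗ hB.RadicalGroup) ≤ toLex (1, 0) :=
  Prod.Lex.toLex_le_toLex.2 (Or.inl one_pos)

/-- The mixed case of additivity. One has `r ⊕ ¬s = ¬(s ⊖ r)` with `s ⊖ r` in the radical: a genuine
difference if `r ≤ s`, and `0` if `s ≤ r`, where the right side is truncated. -/
theorem toLexGroup_add_neg (r s : hB.radical) :
    hB.toLexGroup ((r : B) + neg (s : B)) =
      min (toLex (0, hB.ofRadical r) + toLex (1, -hB.ofRadical s)) (toLex (1, 0)) := by
  rw [IsLexRepresentation.lex_add, zero_add]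
  obtain ⟨d, hd⟩ : ∃ d : hB.radical, (d : B) = diff (s : B) r :=
    ⟨⟨_, fun h => s.2 (h.mono (diff_le_left _ _))⟩, rfl⟩
  have hrs : (r : B) + neg (s : B) = neg (d : B) := by
    rw [hd, diff, neg_neg, add_comm]
  rw [hrs, hB.toLexGroup_neg]
  rcases _root_.le_total r s with h | h
  · have hs : d + r = s := Subtype.ext ((congrArg (· + (r : B)) hd).trans (diff_add_cancel h))
    rw [← hs, map_add, min_eq_left]
    · congr 2
      abel
    · rw [Prod.Lex.toLex_le_toLex]
      refine Or.inr ⟨rfl, ?_⟩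
      simpa using hB.ofRadical_nonneg d
  · have hd0 : d = 0 := Subtype.ext (hd.trans (diff_eq_zero.2 h))
    rw [hd0, map_zero, neg_zero, min_eq_right]
    rw [Prod.Lex.toLex_le_toLex]
    refine Or.inr ⟨rfl, ?_⟩
    rw [← sub_eq_add_neg, sub_nonneg, ofRadical_le_iff]
    exact h

theorem isLexRepresentation : IsLexRepresentation hB.toLexGroup where
  nonneg x := by
    rw [← toLex_zero]
    obtain ⟨r, rfl | rfl⟩ := hB.exists_radical x
    · rw [hB.toLexGroup_coe]
      exact Prod.Lex.toLex_le_toLex.2 (Or.inr ⟨rfl, hB.ofRadical_nonneg r⟩)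
    · rw [hB.toLexGroup_neg]
      exact Prod.Lex.toLex_le_toLex.2 (Or.inl one_pos)
  le_unit x := by
    obtain ⟨r, rfl | rfl⟩ := hB.exists_radical x
    · rw [hB.toLexGroup_coe]
      exact hB.toLexGroup_coe_le r
    · rw [hB.toLexGroup_neg]
      exact Prod.Lex.toLex_le_toLex.2 (Or.inr ⟨rfl, neg_nonpos.2 (hB.ofRadical_nonneg r)⟩)
  map_zero := by
    have := hB.toLexGroup_coe 0
    rwa [map_zero] at this
  map_add x y := by
    obtain ⟨r, rfl | rfl⟩ := hB.exists_radical x <;> obtain ⟨s, rfl | rfl⟩ := hB.exists_radical y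
    · rw [← AddSubmonoid.coe_add, hB.toLexGroup_coe, hB.toLexGroup_coe, hB.toLexGroup_coe,
        IsLexRepresentation.lex_add, ← map_add, add_zero, min_eq_left (hB.toLexGroup_coe_le _)]
    · rw [hB.toLexGroup_add_neg, hB.toLexGroup_coe, hB.toLexGroup_neg]
    · rw [add_comm, hB.toLexGroup_add_neg, hB.toLexGroup_coe, hB.toLexGroup_neg, add_comm]
    -- The sum is `1` because `¬r ⊕ ¬s = 1` is another form of `r ≤ ¬s`.
    · have h1 : neg (r : B) + neg (s : B) = neg ((0 : hB.radical) : B) := le_iff.1 (hB.le_neg r s)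
      rw [h1, hB.toLexGroup_neg, hB.toLexGroup_neg, hB.toLexGroup_neg, map_zero, neg_zero,
        IsLexRepresentation.lex_add, min_eq_right]
      exact Prod.Lex.toLex_le_toLex.2 (Or.inl (by norm_num))
  map_neg x := by
    obtain ⟨r, rfl | rfl⟩ := hB.exists_radical x
    · rw [hB.toLexGroup_coe, hB.toLexGroup_neg, IsLexRepresentation.lex_sub, sub_zero, zero_sub]
    · rw [hB.toLexGroup_neg, MVAlgebra.neg_neg, hB.toLexGroup_coe, IsLexRepresentation.lex_sub, sub_self,
        sub_neg_eq_add, zero_add]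
  injective x y h := by
    have hne : ∀ a b : hB.RadicalGroup, (toLex (0, a) : ℤ ×ₗ hB.RadicalGroup) ≠ toLex (1, b) :=
      fun a b h => zero_ne_one (congrArg (fun p => (ofLex p).1) h)
    obtain ⟨r, rfl | rfl⟩ := hB.exists_radical x <;> obtain ⟨s, rfl | rfl⟩ := hB.exists_radical y
    · rw [hB.toLexGroup_coe, hB.toLexGroup_coe] at h
      rw [hB.ofRadical_injective (congrArg (fun p => (ofLex p).2) h)]
    · rw [hB.toLexGroup_coe, hB.toLexGroup_neg] at h
      exact absurd h (hne _ _)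
    · rw [hB.toLexGroup_coe, hB.toLexGroup_neg] at h
      exact absurd h.symm (hne _ _)
    · rw [hB.toLexGroup_neg, hB.toLexGroup_neg] at h
      rw [hB.ofRadical_injective (_root_.neg_injective (congrArg (fun p => (ofLex p).2) h))]

/-- Perfect chains satisfy the equations of the Chang algebra. -/
theorem satisfiesEq (hB : IsPerfectChain B) {e : MVTerm ℕ × MVTerm ℕ} (he : SatisfiesEq Chang e) : SatisfiesEq B e :=
  hB.isLexRepresentation.satisfiesEq he

end IsPerfectChain

end MVAlgebra

/-! ### Identities expressing that `x ∧ ¬x` is infinitesimal. -/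

namespace MVTerm

/-- The term `n x`. -/
def nsmul {X : Type u} (n : ℕ) (t : MVTerm X) : MVTerm X :=
  match n with
  | 0 => zero
  | n + 1 => (nsmul n t).add t

theorem eval_nsmul {X : Type v} {A : Type u} [MVAlgebra A] (ρ : X → A) (n : ℕ) (t : MVTerm X) :
    (t.nsmul n).eval ρ = n • t.eval ρ := by
  induction n with
  | zero => rw [zero_nsmul]; rfl
  | succ n ih => rw [succ_nsmul, ← ih]; rfl

/-- The term `x ∧ ¬x`. -/
def meetNeg {X : Type u} (t : MVTerm X) : MVTerm X :=
  (((t.neg.neg.add t.neg.neg).neg.add t.neg.neg)).neg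

theorem eval_meetNeg {X : Type v} {A : Type u} [MVAlgebra A] (ρ : X → A) (t : MVTerm X) :
    t.meetNeg.eval ρ = MVAlgebra.meet (t.eval ρ) (MVAlgebra.neg (t.eval ρ)) := by
  change MVAlgebra.neg (MVAlgebra.neg (MVAlgebra.neg (MVAlgebra.neg (eval ρ t)) +
    MVAlgebra.neg (MVAlgebra.neg (eval ρ t))) + MVAlgebra.neg (MVAlgebra.neg (eval ρ t))) = _
  rfl

theorem eval_proj {A : Type u} [MVAlgebra A] (I : MVIdeal A) {X : Type v} (ρ : X → A)
    (t : MVTerm X) : t.eval (fun x => I.proj (ρ x)) = I.proj (t.eval ρ) := by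
  induction t with
  | var x => rfl
  | zero => rfl
  | add s t ihs iht => rw [eval, ihs, iht]; rfl
  | neg t ih => rw [eval, ih]; rfl

end MVTerm

theorem Chang.val_le_of_le {x y : Chang} (h : le x y) : x.1 ≤ y.1 := by
  obtain ⟨z, rfl⟩ := le_iff_exists.1 h
  rw [Chang.val_add]
  exact le_min (le_add_of_nonneg_right z.2.1) x.2.2

/-- The identities `n (x ∧ ¬x) ≤ ¬(x ∧ ¬x)` of the Chang algebra. -/
theorem Chang.nsmul_meet_neg_le (x : Chang) (n : ℕ) :
    le (n • meet x (neg x)) (neg (meet x (neg x))) := by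
  set z := meet x (neg x)
  have h1 : z.1 ≤ x.1 := Chang.val_le_of_le (meet_le_left _ _)
  have h2 : z.1 ≤ toLex (1, 0) - x.1 := Chang.val_le_of_le (meet_le_right x (neg x))
  -- The first coordinate `m` of `z` satisfies `m ≤ k` and `m ≤ 1 - k`, hence `m = 0`. Multiples of
  -- `z` keep first coordinate `0`, so `¬(n z) + ¬z` has first coordinate `2` before truncation to
  -- `1`.
  obtain ⟨b, hb⟩ : ∃ b : ℤ, z.1 = toLex (0, b) := by
    have h0 := z.2.1
    obtain ⟨⟨m, b⟩, hz⟩ := toLex.surjective z.1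
    obtain ⟨⟨k, c⟩, hx⟩ := toLex.surjective x.1
    rw [← hz] at h0 h1 h2
    rw [← hx] at h1 h2
    rw [IsLexRepresentation.lex_sub] at h2
    rw [← toLex_zero] at h0
    rw [Prod.Lex.toLex_le_toLex] at h0 h1 h2
    simp only [Prod.fst_zero, Prod.snd_zero] at h0 h1 h2
    obtain rfl : m = 0 := by omega
    exact ⟨b, hz.symm⟩
  have hn : ∀ n : ℕ, ∃ c : ℤ, (n • z).1 = toLex (0, c) := by
    intro n
    induction n with
    | zero => exact ⟨0, by rw [zero_nsmul]; rfl⟩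
    | succ n ih =>
      obtain ⟨c, hc⟩ := ih
      refine ⟨c + b, ?_⟩
      rw [succ_nsmul, Chang.val_add, hc, hb, IsLexRepresentation.lex_add, add_zero, min_eq_left]
      exact Prod.Lex.toLex_le_toLex.2 (Or.inl one_pos)
  obtain ⟨c, hc⟩ := hn n
  rw [le_iff]
  apply Subtype.ext
  rw [Chang.val_add, Chang.val_neg, Chang.val_neg, hb, hc, IsLexRepresentation.lex_sub,
    IsLexRepresentation.lex_sub, IsLexRepresentation.lex_add, min_eq_right]
  · rfl
  · exact Prod.Lex.toLex_le_toLex.2 (Or.inl (by norm_num))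

/-- An inequality `u ≤ v` is the equation `¬u ⊕ v = 1`, so it passes from the Chang algebra to its
variety. -/
theorem InVarietyGeneratedBy.nsmul_meet_neg_le {A : Type u} [MVAlgebra A]
    (hA : InVarietyGeneratedBy Chang A) (x : A) (n : ℕ) :
    le (n • meet x (neg x)) (neg (meet x (neg x))) := by
  have h := hA {(((MVTerm.var 0).meetNeg.nsmul n).neg.add (MVTerm.var 0).meetNeg.neg,
    MVTerm.zero.neg)} (by
      rintro _ rfl ρ
      simp only [MVTerm.eval, MVTerm.eval_nsmul, MVTerm.eval_meetNeg]
      exact le_iff.1 (Chang.nsmul_meet_neg_le _ _)) _ rfl (fun _ => x)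
  simp only [MVTerm.eval, MVTerm.eval_nsmul, MVTerm.eval_meetNeg] at h
  exact le_iff.2 h

/-! ### The implications between the variety, maximal ideals and prime ideals. -/

namespace MVIdeal

variable {A : Type u} [MVAlgebra A]

theorem IsMaximal.isPrime {M : MVIdeal A} (hM : M.IsMaximal) : M.IsPrime :=
  (M.isMaximal_iff.1 hM).isPrime

theorem IsMaximal.isSupermaximal_iff {M : MVIdeal A} (hM : M.IsMaximal) :
    M.IsSupermaximal ↔ ∀ x : A, x ∈ M.carrier ∨ neg x ∈ M.carrier := by
  have h : (Set.univ : Set M.Quot) = {0, 1} ↔ ∀ q : M.Quot, q = 0 ∨ q = 1 := by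
    rw [eq_comm, Set.eq_univ_iff_forall]
    rfl
  rw [IsSupermaximal, h, M.proj_surjective.forall]
  simp only [proj_eq_zero_iff, proj_eq_one_iff, hM, true_and]

theorem isSupermaximal_of_inVariety (hA : InVarietyGeneratedBy Chang A) {M : MVIdeal A}
    (hM : M.IsMaximal) : M.IsSupermaximal := by
  rw [hM.isSupermaximal_iff]
  intro x
  apply hM.isPrime.2
  -- If `z = x ∧ ¬x` is not in `M`, maximality gives `p + n z = 1` with `p ∈ M`, that is, `¬(n z) ≤
  -- p`. The identity gives `z ≤ ¬(n z)`, so `z ∈ M` after all.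
  by_contra hz
  obtain ⟨p, hp, n, hn⟩ := (M.isMaximal_iff.1 hM).mem_adjoin hz
  apply hz
  have h := neg_le_neg' (hA.nsmul_meet_neg_le x n)
  rw [MVAlgebra.neg_neg] at h
  refine M.mem_of_le hp (le_trans' h ?_)
  rw [le_iff, MVAlgebra.neg_neg, add_comm]
  exact eq_one_of_le hn

theorem IsPrime.isPerfect {P : MVIdeal A} (hP : P.IsPrime)
    (hA : ∀ M : MVIdeal A, M.IsMaximal → M.IsSupermaximal) : P.IsPerfect := by
  rw [isPerfect_iff]
  intro x
  have h1 : (∃ n : ℕ, neg (n • x) ∈ P.carrier) ∨ ∃ n : ℕ, neg (n • neg x) ∈ P.carrier := by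
    rcases hP.le_total (P.proj x) (P.proj (neg x)) with h | h <;> rw [proj_le_iff] at h
    · right
      refine ⟨2, ?_⟩
      rw [two_nsmul]
      rw [diff] at h
      exact h
    · left
      refine ⟨2, ?_⟩
      rw [two_nsmul]
      rwa [diff, MVAlgebra.neg_neg] at h
  have h2 : ¬ ((∃ n : ℕ, neg (n • x) ∈ P.carrier) ∧ ∃ n : ℕ, neg (n • neg x) ∈ P.carrier) := by
    rintro ⟨⟨n, hn⟩, m, hm⟩
    have h1P : (1 : A) ∉ P.carrier := fun h => hP.1 (P.carrier_eq_univ_iff.2 h)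
    obtain ⟨M, hPM, hM⟩ := P.exists_isMaximalAvoiding h1P
    have hmax := M.isMaximal_iff.2 hM
    -- An element of `M` has all its multiples in `M`, so none of them is `1` modulo `M`.
    have key : ∀ (y : A) (n : ℕ), y ∈ M.carrier → neg (n • y) ∉ M.carrier := by
      intro y n hy hy'
      have := M.add_mem hy' (M.nsmul_mem hy n)
      rw [neg_add_self] at this
      exact hM.1 this
    rcases hmax.isSupermaximal_iff.1 (hA M hmax) x with h | h
    · exact key _ _ h (hPM hn)
    · exact key _ _ h (hPM hm)
  rcases h1 with h | h
  · exact Or.inl ⟨h, fun h' => h2 ⟨h, h'⟩⟩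
  · exact Or.inr ⟨h, fun h' => h2 ⟨h', h⟩⟩

theorem inVariety_of_forall_isPerfect (hA : ∀ P ∈ Spec A, P.IsPerfect) :
    InVarietyGeneratedBy Chang A := by
  intro E hE e he ρ
  by_contra hne
  -- For a failing equation the distance of the two values is nonzero. An ideal containing `{0}` and
  -- maximal avoiding this distance is prime, and the equation still fails in its quotient.
  have hd : mvDist (e.1.eval ρ) (e.2.eval ρ) ∉
      (⟨{0}, ⟨0, rfl⟩, by rintro _ _ rfl rfl; exact add_zero _, by
        rintro _ y rfl h; exact eq_zero_of_le h⟩ : MVIdeal A).carrier :=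
    fun h => hne (eq_of_mvDist_eq_zero h)
  obtain ⟨P, -, hP⟩ := exists_isMaximalAvoiding _ hd
  have hchain : IsPerfectChain P.Quot := ⟨hP.isPrime.le_total, hA P hP.isPrime⟩
  have h := hchain.satisfiesEq (hE e he) (fun x => P.proj (ρ x))
  rw [MVTerm.eval_proj, MVTerm.eval_proj, proj_eq_iff] at h
  exact hP.1 h

/-! ### Correspondence of prime ideals under the quotient map. -/

/-- The image in `A / I` of an ideal of `A`. -/
def map (I P : MVIdeal A) : MVIdeal I.Quot where
  carrier := I.proj '' P.carrier
  nonempty := P.nonempty.image _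
  add_mem := by
    rintro _ _ ⟨x, hx, rfl⟩ ⟨y, hy, rfl⟩
    exact ⟨x + y, P.add_mem hx hy, rfl⟩
  mem_of_le := by
    rintro _ y ⟨x, hx, rfl⟩ h
    obtain ⟨y, rfl⟩ := I.proj_surjective y
    -- A representative of the smaller class need not lie in `P`; its meet with `x` does, and has
    -- the same class.
    refine ⟨meet x y, P.mem_of_le hx (meet_le_left _ _), ?_⟩
    rw [proj_meet]
    exact le_antisymm' (meet_le_right _ _) (le_meet h (le_self _))

/-- Membership in `P` does not depend on the representative: `x ≤ (x ⊖ y) + y`, and `x ⊖ y` lies in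
`I ⊆ P` when the classes agree. -/
theorem proj_mem_map_iff {I P : MVIdeal A} (h : I.carrier ⊆ P.carrier) {x : A} :
    I.proj x ∈ (I.map P).carrier ↔ x ∈ P.carrier := by
  constructor
  · rintro ⟨y, hy, hxy⟩
    have h' : le (I.proj x) (I.proj y) := hxy ▸ le_self _
    rw [proj_le_iff] at h'
    exact P.mem_of_le (P.add_mem (h h') hy) (le_diff_add x y)
  · exact fun hx => ⟨x, hx, rfl⟩

/-- The preimage in `A` of an ideal of `A / I`. -/
def comap (I : MVIdeal A) (Q : MVIdeal I.Quot) : MVIdeal A where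
  carrier := I.proj ⁻¹' Q.carrier
  nonempty := ⟨0, Q.zero_mem⟩
  add_mem hx hy := Q.add_mem hx hy
  mem_of_le hx h := Q.mem_of_le hx (congrArg I.proj h)

theorem subset_comap (I : MVIdeal A) (Q : MVIdeal I.Quot) : I.carrier ⊆ (I.comap Q).carrier := by
  intro x hx
  change I.proj x ∈ Q.carrier
  rw [I.proj_eq_zero_iff.2 hx]
  exact Q.zero_mem

/-- Ideals of `A / I` and of `A` with corresponding carriers have the same properties. -/
theorem isPrime_iff_of_proj {I P : MVIdeal A} {Q : MVIdeal I.Quot}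
    (h : ∀ x, I.proj x ∈ Q.carrier ↔ x ∈ P.carrier) : Q.IsPrime ↔ P.IsPrime := by
  simp only [IsPrime, ne_eq, carrier_eq_univ_iff, I.proj_surjective.forall, ← proj_meet,
    ← I.proj_one, h]

theorem isPerfect_iff_of_proj {I P : MVIdeal A} {Q : MVIdeal I.Quot}
    (h : ∀ x, I.proj x ∈ Q.carrier ↔ x ∈ P.carrier) : Q.IsPerfect ↔ P.IsPerfect := by
  simp only [isPerfect_iff, I.proj_surjective.forall, ← proj_neg, ← proj_nsmul, h]

theorem forall_spec_isPerfect_iff (I : MVIdeal A) :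
    (∀ Q ∈ Spec I.Quot, Q.IsPerfect) ↔ ∀ P ∈ V I.carrier, P.IsPerfect := by
  constructor
  · rintro h P ⟨hP, hIP⟩
    have hiff := fun x => proj_mem_map_iff hIP (x := x)
    exact (isPerfect_iff_of_proj hiff).1 (h _ ((isPrime_iff_of_proj hiff).2 hP))
  · intro h Q hQ
    have hiff : ∀ x, I.proj x ∈ Q.carrier ↔ x ∈ (I.comap Q).carrier := fun _ => Iff.rfl
    exact (isPerfect_iff_of_proj hiff).2
      (h _ ⟨(isPrime_iff_of_proj hiff).1 hQ, I.subset_comap Q⟩)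

end MVIdeal

/-- For an MV-algebra `A = Free(k)/I` the following are equivalent: `A` is in the variety
generated by the Chang algebra; every maximal ideal of `A` is supermaximal; every element of
`Spec(A)` is a perfect ideal; every element of `V(I) ⊆ Spec(Free(k))` is a perfect ideal. -/
theorem theorem8 (k : Type*) (I : MVIdeal (FreeMV k)) :
    List.TFAE
      [InVarietyGeneratedBy Chang I.Quot,
       ∀ M : MVIdeal I.Quot, M.IsMaximal → M.IsSupermaximal,
       ∀ P ∈ MVIdeal.Spec I.Quot, P.IsPerfect,
       ∀ P ∈ MVIdeal.V I.carrier, P.IsPerfect] := by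
  tfae_have 1 → 2 := fun h M hM => MVIdeal.isSupermaximal_of_inVariety h hM
  tfae_have 2 → 3 := fun h P hP => MVIdeal.IsPrime.isPerfect hP h
  tfae_have 3 → 1 := MVIdeal.inVariety_of_forall_isPerfect
  tfae_have 3 ↔ 4 := I.forall_spec_isPerfect_iff
  tfae_finish
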